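/- Let $A$ be a finite set, $p\ge 2$, and let $\tau:A\to A^p$ be a substitution of constant length $p$, extended by concatenation to finite words and to $A^{\mathbb Z}$ (so that $\tau(x)=\dots\tau(x_{-1}).\tau(x_0)\tau(x_1)\dots$). Assume that $\tau$ is one-to-one ($\tau(a)\ne\tau(b)$ for letters $a\neq b$) and primitive (for some $n$, every letter occurs in $\tau^n(b)$ for every letter $b$). Let $T$ be the shift $(Tx)_i=x_{i+1}$ on $A^{\mathbb Z}$, and let $X_\tau\subseteq A^{\mathbb Z}$ be the substitution subshift, i.e. the set of sequences all of whose finite sub-words occur in some $\tau^n(a)$, $n\ge 0$, $a\in A$. Assume that $X_\tau$ is infinite. Let $\varrho(x,y)=2^{-\min\{|i|:x_i\ne y_i\}}$ for $x\neq y$ and $\varrho(x,x)=0$ (any metric compatible with the topology of $X_\tau$ gives the same notions below). A pair $(x,y)\in X_\tau^2$ is distal if $\liminf_{n\to\infty}\varrho(T^nx,T^ny)>0$, proximal if this $\liminf$ is $0$, asymptotic if $\lim_{n\to\infty}\varrho(T^nx,T^ny)=0$, and a Li–Yorke pair if it is proximal but not asymptotic. For every $x\in X_\tau$ there are unique sequences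 $(x^{(i)})_{i\ge0}$ in $X_\tau$ and $(\delta_i)_{i\ge 0}$ in $\{0,\dots,p-1\}$ with $x^{(0)}=x$ and $\tau(x^{(i+1)})=T^{-\delta_i}(x^{(i)})$ for all $i\ge 0$. Put $\pi(x)=(\delta_i)_{i\ge0}$ (a point of the $p$-odometer written in base $p$), let $s_i(x)=x^{(i)}_1x^{(i)}_2\cdots x^{(i)}_{p-1-\delta_i}$ (the empty word if $\delta_i=p-1$), and let $\mathcal I^+(x)=\{i\ge 0: s_i(x)\text{ is not empty}\}$. If $\mathcal I^+(x)$ is finite, let $k^+(x)=\max\{|x_0\,s_0(x)\,\tau(s_1(x))\cdots\tau^i(s_i(x))| : i\in\mathcal I^+(x)\}$, with $k^+(x)=|x_0|=1$ if $\mathcal I^+(x)=\emptyset$. The set $\mathcal I^+(x)$ and the number $k^+(x)$ depend only on $\pi(x)$. **Proposition 3.4.** Let $x,y\in X_\tau$ with $\pi(x)=\pi(y)$; put $\mathcal I=\mathcal I^+(x)=\mathcal I^+(y)$ and, if $\mathcal I$ is finite, $k=k^+(x)=k^+(y)$. 1. $(x,y)$ is asymptotic if and only if either $\mathcal I$ is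 infinite and $s_i(x)=s_i(y)$ for all sufficiently large $i$, or $\mathcal I$ is finite and $s_i(T^kx)=s_i(T^ky)$ for all sufficiently large $i$. 2. Assume that $\tau$ has no coincidences, i.e. for all letters $a\ne b$ the words $\tau(a)$ and $\tau(b)$ differ at every coordinate. If there is $i\in\mathbb Z$ with $x_i\neq y_i$ and $\mathcal I^+(T^ix)$ infinite, then $(x,y)$ is distal; otherwise $(x,y)$ is asymptotic. Moreover, if $\tau$ has no coincidences, then $(X_\tau,T)$ has no Li–Yorke pairs at all (whether or not in the same fibre of $\pi$). -/

import Mathlib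

open Filter Topology

namespace Subst

noncomputable section

/-! ### Pairs in a dynamical system

`X` is the phase space inside the ambient set `E`, `ρ` the distance, `T` the transformation. -/

/-- Distal pairs of `(X, T)`: `liminf ρ (T^n x) (T^n y) > 0`. -/
def distalPairs {E : Type*} (X : Set E) (ρ : E → E → ℝ) (T : E → E) : Set (E × E) :=
  {q | q.1 ∈ X ∧ q.2 ∈ X ∧ 0 < liminf (fun n : ℕ => ρ (T^[n] q.1) (T^[n] q.2)) atTop}

/-- Proximal pairs of `(X, T)`: `liminf ρ (T^n x) (T^n y) = 0`. -/
def proximalPairs {E : Type*} (X : Set E) (ρ : E → E → ℝ) (T : E → E) : Set (E × E) :=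
  {q | q.1 ∈ X ∧ q.2 ∈ X ∧ liminf (fun n : ℕ => ρ (T^[n] q.1) (T^[n] q.2)) atTop = 0}

/-- Asymptotic pairs of `(X, T)`: `lim ρ (T^n x) (T^n y) = 0`. -/
def asymptoticPairs {E : Type*} (X : Set E) (ρ : E → E → ℝ) (T : E → E) : Set (E × E) :=
  {q | q.1 ∈ X ∧ q.2 ∈ X ∧ Tendsto (fun n : ℕ => ρ (T^[n] q.1) (T^[n] q.2)) atTop (𝓝 0)}

/-- Li-Yorke pairs: proximal and not asymptotic. -/
def liYorkePairs {E : Type*} (X : Set E) (ρ : E → E → ℝ) (T : E → E) : Set (E × E) :=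
  proximalPairs X ρ T \ asymptoticPairs X ρ T

/-! ### Two-sided sequences -/

/-- The shift map `T` on two-sided sequences. -/
def shift {A : Type*} (x : ℤ → A) : ℤ → A := fun i => x (i + 1)

/-- The power `T ^ n` of the shift, for an integer `n`. -/
def shiftPow {A : Type*} (n : ℤ) (x : ℤ → A) : ℤ → A := fun i => x (i + n)

theorem shift_iterate {A : Type*} (n : ℕ) (x : ℤ → A) : shift^[n] x = shiftPow n x := by
  induction n generalizing x with
  | zero => funext i; simp [shiftPow]
  | succ n ih =>
    rw [Function.iterate_succ_apply, ih]
    funext i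
    simp only [shiftPow, shift]
    congr 1
    push_cast
    ring

theorem shiftPow_add {A : Type*} (m n : ℤ) (x : ℤ → A) :
    shiftPow m (shiftPow n x) = shiftPow (m + n) x := by
  funext i
  simp only [shiftPow]
  congr 1
  ring

open scoped Classical in
/-- The usual distance on two-sided sequences, compatible with the product of the discrete
topologies: `2 ^ (-N)`, where `N` is the least `|i|` with `x i ≠ y i`, and `0` if `x = y`. -/
def seqDist {A : Type*} (x y : ℤ → A) : ℝ :=
  if x = y then 0 else (1 / 2 : ℝ) ^ sInf {n : ℕ | ∃ i : ℤ, i.natAbs = n ∧ x i ≠ y i}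

/-- The sub-word of `x` of length `m` which starts at the coordinate `i`. -/
def subword {A : Type*} (x : ℤ → A) (i : ℤ) (m : ℕ) : List A :=
  List.ofFn fun j : Fin m => x (i + (j : ℕ))

/-! ### Substitutions of constant length `p`

Such a substitution sends each letter to a word of length `p`; it is a map `A → Fin p → A`. -/

/-- Extension of `τ` to finite words by concatenation. -/
def wordMap {A : Type*} {p : ℕ} (τ : A → Fin p → A) (w : List A) : List A :=
  w.flatMap fun a => List.ofFn (τ a)

/-- Extension of `τ` to two-sided sequences, `… τ(x₋₁) . τ(x₀) τ(x₁) …`: the coordinate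
`p * m + j` with `0 ≤ j < p` is the `j`-th letter of `τ (x m)`. -/
def seqMap {A : Type*} {p : ℕ} [NeZero p] (τ : A → Fin p → A) (x : ℤ → A) : ℤ → A :=
  fun n => τ (x (n / (p : ℤ))) (Fin.ofNat p (n % (p : ℤ)).toNat)

/-- For some `n`, every letter occurs in the `n`-th image of every letter. -/
def IsPrimitive {A : Type*} {p : ℕ} (τ : A → Fin p → A) : Prop :=
  ∃ n : ℕ, ∀ a b : A, a ∈ (wordMap τ)^[n] [b]

/-- The substitution subshift `X_τ`: the two-sided sequences all of whose finite sub-words occur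
in some `τ^n(a)`. -/
def substShift {A : Type*} {p : ℕ} (τ : A → Fin p → A) : Set (ℤ → A) :=
  {x | ∀ (i : ℤ) (m : ℕ), ∃ (n : ℕ) (a : A), subword x i m <:+: (wordMap τ)^[n] [a]}

/-- The images of two distinct letters agree at some coordinate. -/
def HasCoincidence {A : Type*} {p : ℕ} (τ : A → Fin p → A) : Prop :=
  ∃ a b : A, a ≠ b ∧ ∃ j : Fin p, τ a j = τ b j

/-- `z i = x^(i)` and `δ` are the points of `X_τ` and the digits associated with `x`:
`x^(0) = x` and `τ(x^(i+1)) = T^(-δ_i) x^(i)`. -/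
def IsExpansion {A : Type*} {p : ℕ} [NeZero p] (τ : A → Fin p → A) (x : ℤ → A)
    (z : ℕ → ℤ → A) (δ : ℕ → Fin p) : Prop :=
  z 0 = x ∧ (∀ i, z i ∈ substShift τ) ∧
    ∀ i, seqMap τ (z (i + 1)) = shiftPow (-((δ i : ℕ) : ℤ)) (z i)

open scoped Classical in
/-- The sequences `(x^(i))` and `(δ_i)` of `x`. For a primitive `τ` with infinite `X_τ` they exist
and are unique for every `x ∈ X_τ`; the value is irrelevant when none exist. -/
def expansion {A : Type*} {p : ℕ} [NeZero p] (τ : A → Fin p → A) (x : ℤ → A) :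
    (ℕ → ℤ → A) × (ℕ → Fin p) :=
  if h : ∃ q : (ℕ → ℤ → A) × (ℕ → Fin p), IsExpansion τ x q.1 q.2 then h.choose
  else (fun _ => x, fun _ => 0)

/-- The point `x^(i)`. -/
def desub {A : Type*} {p : ℕ} [NeZero p] (τ : A → Fin p → A) (x : ℤ → A) (i : ℕ) : ℤ → A :=
  (expansion τ x).1 i

/-- The map `π` to the `p`-odometer, whose points are written as digit sequences in base `p`. -/
def odometerMap {A : Type*} {p : ℕ} [NeZero p] (τ : A → Fin p → A) (x : ℤ → A) : ℕ → Fin p :=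
  (expansion τ x).2

/-- The word `s_i(x)`, that is `x^(i)` read from coordinate `1` to `p - 1 - δ_i`
(the empty word if `δ_i = p - 1`). -/
def sWord {A : Type*} {p : ℕ} [NeZero p] (τ : A → Fin p → A) (x : ℤ → A) (i : ℕ) : List A :=
  subword (desub τ x i) 1 (p - 1 - (odometerMap τ x i : ℕ))

/-- The set `I⁺(x)` of the `i` with `|s_i(x)| ≠ 0`. -/
def iPlus {A : Type*} {p : ℕ} [NeZero p] (τ : A → Fin p → A) (x : ℤ → A) : Set ℕ :=
  {i | (sWord τ x i).length ≠ 0}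

/-- The word `x_0 s_0(x) τ(s_1(x)) ⋯ τ^i(s_i(x))`. -/
def rightWord {A : Type*} {p : ℕ} [NeZero p] (τ : A → Fin p → A) (x : ℤ → A) (i : ℕ) : List A :=
  x 0 :: (List.range (i + 1)).flatMap fun j => (wordMap τ)^[j] (sWord τ x j)

/-- `k⁺(x)`, the largest length of the words `x_0 s_0(x) τ(s_1(x)) ⋯ τ^i(s_i(x))` for `i ∈ I⁺(x)`.
It is meant for finite `I⁺(x)`. When `I⁺(x)` is empty only the letter `x_0` is left and the value
is `1`; inserting `1` changes nothing otherwise. -/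
def kPlus {A : Type*} {p : ℕ} [NeZero p] (τ : A → Fin p → A) (x : ℤ → A) : ℕ :=
  sSup (insert 1 {n : ℕ | ∃ i ∈ iPlus τ x, n = (rightWord τ x i).length})

end

end Subst

/-! Everything rests on unique desubstitution: a point of X_τ lies in T^j τ(X_τ) for exactly one
residue j mod p (`exists_mem_layer`, `emod_eq_of_mem_layer`). Existence is minimality plus
compactness. For uniqueness, consider the pairs of letters found at the last disagreement of two
right-asymptotic points; they form a finite nonempty set P. Two admissible phases would give each
pair in P two desubstitutions in P, at different positions of the block. Since a pair of letters
determines the last disagreement of its images, the first choice of desubstitution is an injection P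
→ P, hence onto, and the second choice collides with it.

Coordinate m of x^(n) is then read off coordinate ⌊(m+δ_n)/p⌋ of x^(n+1). Iterating, a positive
coordinate falls to 1 and reaches 0 at a digit other than p-1, which is available when I⁺ is
infinite (`carry_induction`). The last positive coordinate lies in s_n, so eventual equality of the
s_n gives equality on the positive coordinates of some level, which descends to x and y. Conversely,
an agreeing right tail lifts by injectivity of τ, its starting point shrinking until it is 1. If I⁺
is finite, the shift by k⁺ turns the final digits p-1 into 0 and reduces to the infinite case.

Without coincidences a disagreement at 0 survives at coordinate 0 of every level and comes back down
to all positive coordinates, so the pair is distal; if no such disagreement is available, right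
tails agree. Proximal points share their digits (`IsRecognizable.odometerMap_eq_of_proximal`), so a
Li–Yorke pair would lie in one fibre, where the dichotomy excludes it. -/

namespace Subst

/-! ### Words, minimality, and the action of τ on sequences -/

section Words

variable {A : Type*}

theorem subword_eq_iff (x y : ℤ → A) (i k : ℤ) (m : ℕ) :
    subword x i m = subword y k m ↔ ∀ j : ℕ, j < m → x (i + j) = y (k + j) := by
  unfold subword
  rw [List.ofFn_inj]
  constructor
  · intro h j hj
    exact congrFun h ⟨j, hj⟩
  · intro h
    funext j
    exact h j j.2

@[simp] theorem length_subword (x : ℤ → A) (i : ℤ) (m : ℕ) : (subword x i m).length = m := by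
  simp [subword]

theorem subword_add (x : ℤ → A) (i : ℤ) (m n : ℕ) :
    subword x i (m + n) = subword x i m ++ subword x (i + m) n := by
  apply List.ext_getElem
  · simp
  · intro k h1 h2
    rw [List.getElem_append]
    split_ifs with h
    · simp [subword]
    · simp only [length_subword, not_lt] at h
      simp only [subword, List.getElem_ofFn, List.length_ofFn]
      congr 1
      omega

theorem subword_shiftPow (k : ℤ) (x : ℤ → A) (i : ℤ) (m : ℕ) :
    subword (shiftPow k x) i m = subword x (i + k) m := by
  unfold subword shiftPow
  congr 1
  funext j
  congr 1
  ring

theorem subword_infix (x : ℤ → A) {i k : ℤ} {m n : ℕ} (h1 : k ≤ i) (h2 : i + m ≤ k + n) :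
    subword x i m <:+: subword x k n := by
  obtain ⟨a, rfl⟩ := Int.le.dest h1
  obtain ⟨b, rfl⟩ : ∃ b, n = a + m + b := ⟨n - (a + m), by omega⟩
  rw [subword_add, subword_add]
  exact ⟨_, _, by push_cast; rfl⟩

theorem exists_eq_subword_of_infix {x : ℤ → A} {i : ℤ} {n : ℕ} {l : List A}
    (h : l <:+: subword x i n) : ∃ k : ℕ, l = subword x (i + k) l.length := by
  obtain ⟨s, t, h⟩ := h
  have hn : n = s.length + l.length + t.length := by
    have := congrArg List.length h
    simp at this
    omega
  rw [hn, subword_add, subword_add] at h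
  have h1 := List.append_inj_left h (by simp)
  exact ⟨_, List.append_inj_right h1 (by simp)⟩

/-- At most L letters remain in the block where the window starts, so the next block ends within the
first 2L letters of the window. -/
theorem exists_infix_of_flatMap {B : Type*} (f : B → List A) (L : ℕ) (hL : 0 < L)
    (hf : ∀ b, (f b).length = L)
    (w : List B) (l : List A) (hl : 2 * L ≤ l.length) (h : l <:+: w.flatMap f) :
    ∃ b ∈ w, f b <:+: l := by
  induction w with
  | nil =>
    simp at h
    subst h
    simp at hl
    omega
  | cons b w ih =>
    obtain ⟨s, t, h⟩ := h
    rw [List.flatMap_cons, List.append_assoc, List.append_eq_append_iff] at h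
    rcases h with ⟨r, h1, h2⟩ | ⟨s', h1, h2⟩
    · have hr : r.length ≤ L := by
        rw [← hf b, h1]; simp
      rw [List.append_eq_append_iff] at h2
      have key : ∃ l', l = r ++ l' ∧ l' ++ t = w.flatMap f := by
        rcases h2 with ⟨c, h3, h4⟩ | ⟨c, h3, h4⟩
        · have : c = [] := by
            have := congrArg List.length h3
            simp at this
            exact List.eq_nil_of_length_eq_zero (by omega)
          subst this
          exact ⟨[], by simpa using h3.symm, by simpa using h4⟩
        · exact ⟨c, h3, h4.symm⟩
      obtain ⟨l', rfl, h3⟩ := key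
      simp only [List.length_append] at hl
      cases w with
      | nil =>
        simp at h3
        rw [h3.1] at hl
        simp at hl
        omega
      | cons b' w' =>
        refine ⟨b', by simp, ?_⟩
        rw [List.flatMap_cons] at h3
        have h5 : f b' <+: l' := by
          have h6 : l' <+: f b' ++ w'.flatMap f := ⟨t, h3⟩
          refine List.prefix_of_prefix_length_le ⟨_, rfl⟩ h6 ?_
          rw [hf]; omega
        exact h5.isInfix.trans (List.suffix_append r l').isInfix
    · obtain ⟨b', hb', h3⟩ := ih ⟨s', t, by rw [List.append_assoc, ← h2]⟩
      exact ⟨b', by simp [hb'], h3⟩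

variable {p : ℕ} (τ : A → Fin p → A)

theorem wordMap_append (v w : List A) : wordMap τ (v ++ w) = wordMap τ v ++ wordMap τ w := by
  simp [wordMap]

theorem wordMap_iterate_append (n : ℕ) (v w : List A) :
    (wordMap τ)^[n] (v ++ w) = (wordMap τ)^[n] v ++ (wordMap τ)^[n] w := by
  induction n generalizing v w with
  | zero => rfl
  | succ n ih => simp only [Function.iterate_succ_apply, wordMap_append, ih]

theorem wordMap_iterate_infix (n : ℕ) {v w : List A} (h : v <:+: w) :
    (wordMap τ)^[n] v <:+: (wordMap τ)^[n] w := by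
  obtain ⟨s, t, rfl⟩ := h
  rw [wordMap_iterate_append, wordMap_iterate_append]
  exact ⟨_, _, rfl⟩

theorem length_wordMap (w : List A) : (wordMap τ w).length = w.length * p := by
  simp [wordMap, List.length_flatMap]

theorem length_wordMap_iterate (n : ℕ) (w : List A) :
    ((wordMap τ)^[n] w).length = w.length * p ^ n := by
  induction n generalizing w with
  | zero => simp
  | succ n ih =>
    rw [Function.iterate_succ_apply, ih, length_wordMap]
    ring

theorem wordMap_iterate_eq_flatMap (n : ℕ) (w : List A) :
    (wordMap τ)^[n] w = w.flatMap fun a => (wordMap τ)^[n] [a] := by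
  induction w with
  | nil =>
    exact List.eq_nil_of_length_eq_zero (by simp [length_wordMap_iterate])
  | cons a w ih =>
    rw [List.flatMap_cons, ← ih, ← wordMap_iterate_append]
    rfl

theorem shiftPow_mem_substShift {x : ℤ → A} (hx : x ∈ substShift τ) (k : ℤ) :
    shiftPow k x ∈ substShift τ := by
  intro i m
  rw [subword_shiftPow]
  exact hx _ _

/-- Minimality of the substitution subshift of a primitive substitution. -/
theorem exists_subword_eq (hp : 2 ≤ p) (hprim : IsPrimitive τ) {x u : ℤ → A}
    (hx : x ∈ substShift τ) (hu : u ∈ substShift τ) (i : ℤ) (m : ℕ) :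
    ∃ k : ℕ, subword x i m = subword u k m := by
  obtain ⟨n, a, hxa⟩ := hx i m
  obtain ⟨n₀, hn₀⟩ := hprim
  set L := p ^ (n + n₀) with hLdef
  have hL : 0 < L := by positivity
  obtain ⟨n₁, c, huc⟩ := hu 0 (2 * L)
  -- A word of length 2L fits into τ^n₁(c) only if p^n₁ exceeds L = p^(n+n₀).
  have hle : n + n₀ ≤ n₁ := by
    have h1 := huc.length_le
    rw [length_subword, length_wordMap_iterate] at h1
    simp only [List.length_singleton, one_mul] at h1
    by_contra hlt
    have h2 : p ^ n₁ ≤ L := Nat.pow_le_pow_right (by omega) (by omega)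
    omega
  obtain ⟨r, rfl⟩ := Nat.exists_eq_add_of_le hle
  rw [Function.iterate_add_apply, wordMap_iterate_eq_flatMap] at huc
  obtain ⟨b, -, hb⟩ := exists_infix_of_flatMap _ L hL
    (fun b => by simp [length_wordMap_iterate, hLdef]) _ _ (by simp) huc
  have hab : (wordMap τ)^[n] [a] <:+: (wordMap τ)^[n + n₀] [b] := by
    rw [Function.iterate_add_apply]
    apply wordMap_iterate_infix
    obtain ⟨s, t, h⟩ := List.append_of_mem (hn₀ a b)
    exact ⟨s, t, by rw [h]; simp⟩
  obtain ⟨k, hk⟩ := exists_eq_subword_of_infix ((hxa.trans hab).trans hb)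
  refine ⟨k, ?_⟩
  simpa using hk

variable [NeZero p]

theorem seqMap_apply (u : ℤ → A) (m : ℤ) (t : Fin p) :
    seqMap τ u (p * m + (t : ℕ)) = τ (u m) t := by
  have hp : (0 : ℤ) < p := by exact_mod_cast Nat.pos_of_ne_zero (NeZero.ne p)
  have ht : ((t : ℕ) : ℤ) < p := by exact_mod_cast t.2
  have h1 : ((p : ℤ) * m + (t : ℕ)) / p = m := by
    rw [Int.add_comm, Int.add_mul_ediv_left _ _ hp.ne', Int.ediv_eq_zero_of_lt (by omega) ht]
    simp
  have h2 : ((p : ℤ) * m + (t : ℕ)) % p = (t : ℕ) := by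
    rw [Int.add_comm, Int.add_mul_emod_self_left, Int.emod_eq_of_lt (by omega) ht]
  unfold seqMap
  rw [h1, h2]
  simp

theorem exists_block (n : ℤ) : ∃ t : Fin p, n = p * (n / p) + (t : ℕ) := by
  have hp : (0 : ℤ) < p := by exact_mod_cast Nat.pos_of_ne_zero (NeZero.ne p)
  have h1 := Int.emod_nonneg n hp.ne'
  have h2 := Int.emod_lt_of_pos n hp
  refine ⟨⟨(n % p).toNat, by omega⟩, ?_⟩
  have := Int.mul_ediv_add_emod n p
  simp only [Int.toNat_of_nonneg h1]
  omega

theorem seqMap_shiftPow (k : ℤ) (u : ℤ → A) :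
    seqMap τ (shiftPow k u) = shiftPow (p * k) (seqMap τ u) := by
  funext n
  obtain ⟨t, ht⟩ := exists_block (p := p) n
  rw [ht, seqMap_apply]
  unfold shiftPow
  rw [show (p : ℤ) * (n / p) + (t : ℕ) + p * k = p * (n / p + k) + (t : ℕ) by ring, seqMap_apply]

theorem seqMap_injective (hinj : Function.Injective τ) :
    Function.Injective (seqMap τ : (ℤ → A) → ℤ → A) := by
  intro u v h
  funext m
  apply hinj
  funext t
  rw [← seqMap_apply τ u, ← seqMap_apply τ v, h]

theorem subword_seqMap (u : ℤ → A) (q : ℤ) (m : ℕ) :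
    subword (seqMap τ u) (p * q) (m * p) = wordMap τ (subword u q m) := by
  induction m generalizing q with
  | zero => simp [subword, wordMap]
  | succ m ih =>
    rw [add_mul, one_mul, add_comm, subword_add, add_comm m 1, subword_add, wordMap_append]
    congr 1
    · simp [subword, wordMap, seqMap_apply]
    · rw [show (p : ℤ) * q + p = p * (q + (1 : ℕ)) by push_cast; ring, ih]

theorem seqMap_mem_substShift {u : ℤ → A} (hu : u ∈ substShift τ) :
    seqMap τ u ∈ substShift τ := by
  intro i m
  obtain ⟨n, a, h⟩ := hu (i / p) (m + 1)
  refine ⟨n + 1, a, ?_⟩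
  rw [Function.iterate_succ_apply']
  refine List.IsInfix.trans ?_ (wordMap_iterate_infix τ 1 h)
  rw [Function.iterate_one, ← subword_seqMap]
  obtain ⟨t, ht⟩ := exists_block (p := p) i
  have ht2 := t.2
  have hm : (m : ℤ) ≤ m * p := by
    have : (1 : ℤ) ≤ p := by omega
    nlinarith
  apply subword_infix
  · omega
  · push_cast
    rw [add_mul]
    omega

end Words

/-! ### Compactness and right-asymptotic points -/

section Compactness

variable {A : Type*} [TopologicalSpace A] [DiscreteTopology A]

omit [DiscreteTopology A] in
theorem continuous_shiftPow (k : ℤ) : Continuous (shiftPow k : (ℤ → A) → ℤ → A) :=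
  continuous_pi fun i => continuous_apply (i + k)

theorem isClosed_substShift [Finite A] {p : ℕ} (τ : A → Fin p → A) :
    IsClosed (substShift τ) := by
  have h : substShift τ = ⋂ (i : ℤ) (m : ℕ), (fun x : ℤ → A => fun j : Fin m => x (i + (j : ℕ))) ⁻¹'
      {f | ∃ (n : ℕ) (a : A), List.ofFn f <:+: (wordMap τ)^[n] [a]} := by
    ext x
    simp [substShift, subword]
  rw [h]
  refine isClosed_iInter fun i => isClosed_iInter fun m => IsClosed.preimage ?_ (isClosed_discrete _)
  exact continuous_pi fun j => continuous_apply _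

theorem continuous_seqMap {p : ℕ} [NeZero p] (τ : A → Fin p → A) :
    Continuous (seqMap τ : (ℤ → A) → ℤ → A) :=
  continuous_pi fun n =>
    (continuous_of_discreteTopology (f := fun a => τ a (Fin.ofNat p (n % (p : ℤ)).toNat))).comp
      (continuous_apply (n / (p : ℤ)))

/-- Pairs in a compact set which agree on longer and longer windows accumulate at a pair which
agrees on the union of the windows. -/
theorem exists_mem_forall_eq_of_isClosed [Finite A] {K : Set ((ℤ → A) × (ℤ → A))} (hK : IsClosed K)
    (S : ℕ → Set ℤ) (hS : Monotone S)
    (h : ∀ N, ∃ q ∈ K, ∀ i ∈ S N, q.1 i = q.2 i) :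
    ∃ q ∈ K, ∀ N, ∀ i ∈ S N, q.1 i = q.2 i := by
  have hcl : ∀ N, IsClosed (K ∩ {q : (ℤ → A) × (ℤ → A) | ∀ i ∈ S N, q.1 i = q.2 i}) := by
    intro N
    refine hK.inter ?_
    simp only [Set.ofPred_forall]
    refine isClosed_iInter fun i => isClosed_iInter fun _ => ?_
    exact isClosed_eq ((continuous_apply i).comp continuous_fst)
      ((continuous_apply i).comp continuous_snd)
  obtain ⟨q, hq⟩ := IsCompact.nonempty_iInter_of_sequence_nonempty_isCompact_isClosed
    (fun N => K ∩ {q : (ℤ → A) × (ℤ → A) | ∀ i ∈ S N, q.1 i = q.2 i})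
    (fun N q hq => ⟨hq.1, fun i hi => hq.2 i (hS (Nat.le_succ N) hi)⟩)
    (fun N => by obtain ⟨q, h1, h2⟩ := h N; exact ⟨q, h1, h2⟩)
    (hcl 0).isCompact hcl
  rw [Set.mem_iInter] at hq
  exact ⟨q, (hq 0).1, fun N => (hq N).2⟩

theorem inter_nonempty_of_forall_eq [Finite A] {C D : Set (ℤ → A)} (hC : IsClosed C)
    (hD : IsClosed D)
    (h : ∀ N : ℕ, ∃ x ∈ C, ∃ y ∈ D, ∀ i : ℤ, i.natAbs ≤ N → x i = y i) : (C ∩ D).Nonempty := by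
  obtain ⟨⟨x, y⟩, ⟨hx, hy⟩, hq⟩ := exists_mem_forall_eq_of_isClosed (hC.prod hD)
    (fun N => {i : ℤ | i.natAbs ≤ N}) (fun M N hMN i hi => le_trans hi hMN)
    (fun N => by
      obtain ⟨x, hx, y, hy, hxy⟩ := h N
      exact ⟨(x, y), ⟨hx, hy⟩, hxy⟩)
  have : x = y := funext fun i => hq i.natAbs i (le_refl i.natAbs)
  subst this
  exact ⟨x, hx, hy⟩

/-- An infinite subshift contains two points which agree exactly from the coordinate `0` on. -/
theorem exists_eq_on_nonneg [Finite A] {X : Set (ℤ → A)} (hX : IsClosed X)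
    (hshift : ∀ x ∈ X, ∀ k, shiftPow k x ∈ X) (hinf : X.Infinite) :
    ∃ x ∈ X, ∃ y ∈ X, x (-1) ≠ y (-1) ∧ ∀ i, -1 < i → x i = y i := by
  by_contra hno
  push Not at hno
  -- Without such a pair, compactness bounds the length of window needed to determine the letter on
  -- its left.
  have hN : ∃ N : ℕ, ∀ x ∈ X, ∀ y ∈ X, (∀ i : ℤ, 0 ≤ i → i < N → x i = y i) →
      x (-1) = y (-1) := by
    by_contra hcon
    push Not at hcon
    have hK : IsClosed ((X ×ˢ X) ∩ {q : (ℤ → A) × (ℤ → A) | q.1 (-1) ≠ q.2 (-1)}) := by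
      refine (hX.prod hX).inter ?_
      exact (isClosed_discrete {q : A × A | q.1 ≠ q.2}).preimage
        (f := fun q : (ℤ → A) × (ℤ → A) => (q.1 (-1), q.2 (-1)))
        (((continuous_apply _).comp continuous_fst).prodMk
          ((continuous_apply _).comp continuous_snd))
    obtain ⟨⟨x, y⟩, ⟨⟨hx, hy⟩, hne⟩, hq⟩ := exists_mem_forall_eq_of_isClosed hK
      (fun N => {i : ℤ | 0 ≤ i ∧ i < N})
      (fun M N hMN i hi => ⟨hi.1, lt_of_lt_of_le hi.2 (by exact_mod_cast hMN)⟩)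
      (fun N => by
        obtain ⟨x, hx, y, hy, hxy, hne⟩ := hcon N
        exact ⟨(x, y), ⟨⟨hx, hy⟩, hne⟩, fun i hi => hxy i hi.1 hi.2⟩)
    obtain ⟨i, hi, hi2⟩ := hno x hx y hy hne
    exact hi2 (hq (i.toNat + 1) i ⟨by omega, by push_cast; omega⟩)
  obtain ⟨N, hN⟩ := hN
  have hleft : ∀ x ∈ X, ∀ y ∈ X, ∀ l : ℤ, (∀ i : ℤ, l ≤ i → i < l + N → x i = y i) →
      ∀ d : ℕ, ∀ i : ℤ, l - d ≤ i → i < l + N → x i = y i := by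
    intro x hx y hy l h d
    induction d with
    | zero => simpa using h
    | succ d ih =>
      intro i h1 h2
      by_cases hi : l - d ≤ i
      · exact ih i hi h2
      · have := hN _ (hshift x hx (i + 1)) _ (hshift y hy (i + 1)) (by
          intro j hj1 hj2
          exact ih _ (by push_cast at h1; omega) (by push_cast at h1; omega))
        simpa [shiftPow] using this
  -- More points than words of length N: two of them share the word at l, hence agree to the left of
  -- l, where points of F are separated.
  obtain ⟨F, hFX, hFcard⟩ := hinf.exists_subset_card_eq (Nat.card (Fin N → A) + 1)
  have hsep : ∃ l : ℤ, ∀ x ∈ F, ∀ y ∈ F, x ≠ y → ∃ i < l, x i ≠ y i := by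
    have h1 : ∀ q : (ℤ → A) × (ℤ → A), ∃ i : ℤ, q.1 ≠ q.2 → q.1 i ≠ q.2 i := by
      intro q
      by_cases h : q.1 = q.2
      · exact ⟨0, fun h' => absurd h h'⟩
      · obtain ⟨i, hi⟩ := Function.ne_iff.1 h
        exact ⟨i, fun _ => hi⟩
    choose g hg using h1
    obtain ⟨M, hM⟩ := ((F ×ˢ F).image g).exists_le
    refine ⟨M + 1, fun x hx y hy hxy => ⟨g (x, y), ?_, hg (x, y) hxy⟩⟩
    have := hM (g (x, y)) (Finset.mem_image_of_mem _ (Finset.mk_mem_product hx hy))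
    omega
  obtain ⟨l, hl⟩ := hsep
  have : Fintype (Fin N → A) := Fintype.ofFinite _
  obtain ⟨x, hx, y, hy, hxy, heq⟩ := Finset.exists_ne_map_eq_of_card_lt_of_maps_to
    (s := F) (t := (Finset.univ : Finset (Fin N → A)))
    (f := fun x => fun j : Fin N => x (l + (j : ℕ)))
    (by rw [hFcard, Finset.card_univ, Nat.card_eq_fintype_card]; omega)
    (fun x _ => Finset.mem_univ _)
  obtain ⟨i, hil, hi⟩ := hl x hx y hy hxy
  refine hi (hleft x (hFX hx) y (hFX hy) l ?_ (l - i).toNat i (by omega) (by omega))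
  intro i h1 h2
  have h3 := congrFun heq ⟨(i - l).toNat, by omega⟩
  simp only [] at h3
  rwa [show l + ((i - l).toNat : ℤ) = i by omega] at h3

end Compactness

/-! ### Recognizability -/

section Layers

variable {A : Type*} {p : ℕ} [NeZero p] (τ : A → Fin p → A)

/-- The image `T ^ j (τ (X_τ))`. -/
def layer (j : ℤ) : Set (ℤ → A) :=
  {x | ∃ u ∈ substShift τ, seqMap τ u = shiftPow (-j) x}

theorem shiftPow_zero (x : ℤ → A) : shiftPow 0 x = x := by
  funext i
  simp [shiftPow]

theorem shiftPow_mem_layer {x : ℤ → A} {j : ℤ} (hx : x ∈ layer τ j) (k : ℤ) :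
    shiftPow k x ∈ layer τ (j + k) := by
  obtain ⟨u, hu, h⟩ := hx
  refine ⟨u, hu, ?_⟩
  rw [h, shiftPow_add]
  congr 1
  ring

theorem layer_subset_add_mul (j k : ℤ) : layer τ j ⊆ layer τ (j + p * k) := by
  rintro x ⟨u, hu, h⟩
  refine ⟨shiftPow (-k) u, shiftPow_mem_substShift τ hu _, ?_⟩
  rw [seqMap_shiftPow, h, shiftPow_add]
  congr 1
  ring

theorem layer_add_mul (j k : ℤ) : layer τ (j + p * k) = layer τ j := by
  apply Set.Subset.antisymm
  · have := layer_subset_add_mul τ (j + p * k) (-k)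
    rwa [show j + (p : ℤ) * k + p * -k = j by ring] at this
  · exact layer_subset_add_mul τ j k

omit [NeZero p] in
theorem mem_of_isClosed_of_shift [TopologicalSpace A] [DiscreteTopology A] (hp : 2 ≤ p)
    (hprim : IsPrimitive τ) {x u : ℤ → A} (hx : x ∈ substShift τ) (hu : u ∈ substShift τ)
    {C : Set (ℤ → A)} (hC : IsClosed C) (huC : ∀ k, shiftPow k u ∈ C) : x ∈ C := by
  rw [← hC.closure_eq, mem_closure_iff_nhds]
  intro U hU
  rw [nhds_pi, Filter.mem_pi'] at hU
  obtain ⟨I, t, ht, hIU⟩ := hU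
  obtain ⟨N, hN⟩ := (I.image Int.natAbs).exists_le
  obtain ⟨k, hk⟩ := exists_subword_eq τ hp hprim hx hu (-N) (2 * N + 1)
  rw [subword_eq_iff] at hk
  refine ⟨shiftPow (k + N) u, hIU fun i hi => ?_, huC _⟩
  have hiN := hN _ (Finset.mem_image_of_mem _ hi)
  have h := hk (i + N).toNat (by omega)
  rw [show (-(N : ℤ) + ((i + N).toNat : ℤ)) = i by omega,
    show ((k : ℤ) + ((i + N).toNat : ℤ)) = i + (k + N) by omega] at h
  have h2 := mem_of_mem_nhds (ht i)
  rw [h] at h2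
  exact h2

theorem isClosed_layer [Finite A] [TopologicalSpace A] [DiscreteTopology A] (j : ℤ) :
    IsClosed (layer τ j) := by
  have h1 : IsClosed (seqMap τ '' substShift τ) :=
    ((isClosed_substShift τ).isCompact.image (continuous_seqMap τ)).isClosed
  exact h1.preimage (continuous_shiftPow (-j))

variable [Finite A]

/-- If z = T^a τ(u) lies in layer b, so does T^(pk) z = T^a τ(T^k u) for every k. The orbit of u is
dense and layers are closed, so the whole layer a lies in layer b. -/
theorem layer_eq_of_inter_nonempty (hp : 2 ≤ p) (hprim : IsPrimitive τ) {a b : ℤ}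
    (h : (layer τ a ∩ layer τ b).Nonempty) : layer τ a = layer τ b := by
  let _ : TopologicalSpace A := ⊥
  have : DiscreteTopology A := ⟨rfl⟩
  have key : ∀ a b : ℤ, (layer τ a ∩ layer τ b).Nonempty → layer τ a ⊆ layer τ b := by
    rintro a b ⟨z, ⟨u, hu, hz⟩, hzb⟩ w ⟨v, hv, hw⟩
    have h1 : v ∈ (fun v => shiftPow a (seqMap τ v)) ⁻¹' layer τ b := by
      refine mem_of_isClosed_of_shift τ hp hprim hv hu ((isClosed_layer τ b).preimage
        ((continuous_shiftPow a).comp (continuous_seqMap τ))) fun k => ?_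
      rw [Set.mem_preimage, seqMap_shiftPow, hz, shiftPow_add, shiftPow_add,
        ← layer_add_mul τ b k]
      convert shiftPow_mem_layer τ hzb (p * k) using 2
      ring
    rwa [Set.mem_preimage, hw, shiftPow_add, add_neg_cancel, shiftPow_zero] at h1
  exact (key a b h).antisymm (key b a (by rwa [Set.inter_comm]))

theorem exists_mem_layer (hp : 2 ≤ p) (hprim : IsPrimitive τ) {x : ℤ → A}
    (hx : x ∈ substShift τ) : ∃ t : Fin p, x ∈ layer τ (t : ℕ) := by
  let _ : TopologicalSpace A := ⊥
  have : DiscreteTopology A := ⟨rfl⟩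
  have h : x ∈ ⋃ t : Fin p, layer τ (t : ℕ) := by
    refine mem_of_isClosed_of_shift τ hp hprim hx (seqMap_mem_substShift τ hx)
      (isClosed_iUnion_of_finite fun t => isClosed_layer τ _) fun k => ?_
    obtain ⟨t, ht⟩ := exists_block (p := p) k
    refine Set.mem_iUnion.2 ⟨t, ?_⟩
    rw [← layer_add_mul τ _ (k / p)]
    refine ⟨x, hx, ?_⟩
    rw [shiftPow_add, add_comm ((t : ℕ) : ℤ), ← ht, neg_add_cancel, shiftPow_zero]
  exact Set.mem_iUnion.1 h

/-- Shifts by large multiples of p keep both points in their layers and bring them arbitrarily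
close. The two closed layers therefore meet, hence coincide. -/
theorem mem_layer_of_eq_of_lt (hp : 2 ≤ p) (hprim : IsPrimitive τ) {x y : ℤ → A}
    (hy : y ∈ substShift τ) {r j : ℤ} (hxy : ∀ i, r < i → x i = y i)
    (hxj : x ∈ layer τ j) : y ∈ layer τ j := by
  let _ : TopologicalSpace A := ⊥
  have : DiscreteTopology A := ⟨rfl⟩
  obtain ⟨t, ht⟩ := exists_mem_layer τ hp hprim hy
  rw [layer_eq_of_inter_nonempty τ hp hprim (a := j) (b := (t : ℕ))]
  · exact ht
  · refine inter_nonempty_of_forall_eq (isClosed_layer τ _) (isClosed_layer τ _) fun N => ?_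
    have hm : ∀ k z, z ∈ layer τ k → ∀ m : ℤ, shiftPow (p * m) z ∈ layer τ k := by
      intro k z hz m
      rw [← layer_add_mul τ k m]
      exact shiftPow_mem_layer τ hz _
    refine ⟨_, hm _ _ hxj (|r| + N + 1), _, hm _ _ ht (|r| + N + 1), fun i hi => hxy _ ?_⟩
    have h1 := le_abs_self r
    have h2 : |r| + N + 1 ≤ p * (|r| + N + 1) := by
      have h3 := abs_nonneg r
      have h4 : (2 : ℤ) ≤ p := by exact_mod_cast hp
      nlinarith
    omega

/-- Recognizability of an injective primitive substitution of constant length with infinite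
subshift: the cutting points of a point of the subshift are determined. -/
theorem emod_eq_of_mem_layer (hp : 2 ≤ p) (hinj : Function.Injective τ) (hprim : IsPrimitive τ)
    (hinf : (substShift τ).Infinite) {x : ℤ → A} {a b : ℤ} (ha : x ∈ layer τ a)
    (hb : x ∈ layer τ b) : a % p = b % p := by
  let _ : TopologicalSpace A := ⊥
  have : DiscreteTopology A := ⟨rfl⟩
  by_contra hab
  -- Layers a and b meet, so they coincide, and b - a is a period of the layers.
  have hlayer : ∀ x j, x ∈ layer τ j → x ∈ layer τ (j + (b - a)) := by
    intro x j hx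
    have h1 := shiftPow_mem_layer τ hx (a - j)
    rw [add_sub_cancel, layer_eq_of_inter_nonempty τ hp hprim ⟨_, ha, hb⟩] at h1
    have h2 := shiftPow_mem_layer τ h1 (j - a)
    rw [shiftPow_add, show j - a + (a - j) = 0 by ring, shiftPow_zero] at h2
    rwa [show j + (b - a) = b + (j - a) by ring]
  set P : Set (A × A) := {q | ∃ x ∈ substShift τ, ∃ y ∈ substShift τ, ∃ r : ℤ,
    x r = q.1 ∧ y r = q.2 ∧ q.1 ≠ q.2 ∧ ∀ i, r < i → x i = y i} with hP
  -- The images of the pair c disagree for the last time at position t, where they read q.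
  let R : A × A → Fin p → A × A → Prop := fun c t q =>
    τ c.1 t = q.1 ∧ τ c.2 t = q.2 ∧ q.1 ≠ q.2 ∧ ∀ s, t < s → τ c.1 s = τ c.2 s
  have hR : ∀ c t q t' q', R c t q → R c t' q' → t = t' ∧ q = q' := by
    rintro c t ⟨q1, q2⟩ t' ⟨q1', q2'⟩ ⟨h1, h2, h3, h4⟩ ⟨h1', h2', h3', h4'⟩
    have ht : t = t' := by
      rcases lt_trichotomy t t' with h | h | h
      · exact absurd (by rw [← h1', ← h2', h4 _ h]) h3'
      · exact h
      · exact absurd (by rw [← h1, ← h2, h4' _ h]) h3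
    subst ht
    simp only at h1 h2 h1' h2'
    exact ⟨rfl, by rw [← h1, ← h2, ← h1', ← h2']⟩
  -- Cutting in phases j and j + (b - a) puts the disagreement r at two different positions of its
  -- block.
  have hpre : ∀ q ∈ P, ∃ c₁ ∈ P, ∃ c₂ ∈ P, ∃ t₁ t₂, t₁ ≠ t₂ ∧ R c₁ t₁ q ∧ R c₂ t₂ q := by
    rintro ⟨q1, q2⟩ ⟨x, hx, y, hy, r, hxr, hyr, hne, hxy⟩
    simp only at hxr hyr hne
    have hlift : ∀ j, x ∈ layer τ j →
        ∃ c ∈ P, ∃ t : Fin p, (((t : ℕ) : ℤ) = (r + j) % p) ∧ R c t (q1, q2) := by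
      intro j hxj
      obtain ⟨v, hv, hv2⟩ := mem_layer_of_eq_of_lt τ hp hprim hy hxy hxj
      obtain ⟨u, hu, hu2⟩ := hxj
      have hxu : ∀ m (s : Fin p), τ (u m) s = x (p * m + (s : ℕ) - j) := by
        intro m s
        rw [← seqMap_apply τ u, hu2]
        rfl
      have hyv : ∀ m (s : Fin p), τ (v m) s = y (p * m + (s : ℕ) - j) := by
        intro m s
        rw [← seqMap_apply τ v, hv2]
        rfl
      obtain ⟨t, ht⟩ := exists_block (p := p) (r + j)
      set c := (r + j) / p with hc
      have h1 : τ (u c) t = q1 := by rw [hxu, ← hxr]; congr 1; omega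
      have h2 : τ (v c) t = q2 := by rw [hyv, ← hyr]; congr 1; omega
      refine ⟨(u c, v c), ⟨u, hu, v, hv, c, rfl, rfl, ?_, ?_⟩, t, ?_, h1, h2, hne, ?_⟩
      · intro h
        simp only at h
        rw [h] at h1
        exact hne (h1.symm.trans h2)
      · intro i hi
        apply hinj
        funext s
        rw [hxu, hyv]
        apply hxy
        have h3 : (p : ℤ) * (c + 1) ≤ p * i := by gcongr; omega
        have h4 := t.2
        rw [mul_add, mul_one] at h3
        omega
      · rw [ht, Int.add_comm, Int.add_mul_emod_self_left,
          Int.emod_eq_of_lt (by omega) (by exact_mod_cast t.2)]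
      · intro s hs
        have h5 : (t : ℕ) < (s : ℕ) := hs
        simp only
        rw [hxu, hyv]
        apply hxy
        omega
    obtain ⟨j, hj⟩ := exists_mem_layer τ hp hprim hx
    obtain ⟨c₁, hc₁, t₁, ht₁, hR₁⟩ := hlift _ hj
    obtain ⟨c₂, hc₂, t₂, ht₂, hR₂⟩ := hlift _ (hlayer _ _ hj)
    refine ⟨c₁, hc₁, c₂, hc₂, t₁, t₂, ?_, hR₁, hR₂⟩
    rintro rfl
    apply hab
    have h1 : (r + ((j : ℕ) : ℤ)) ≡ r + (((j : ℕ) : ℤ) + (b - a)) [ZMOD p] := ht₁.symm.trans ht₂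
    have h2 : (p : ℤ) ∣ b - a := by
      have := h1.dvd
      rwa [show r + (((j : ℕ) : ℤ) + (b - a)) - (r + ((j : ℕ) : ℤ)) = b - a by ring] at this
    exact (Int.modEq_iff_dvd.2 h2 : a ≡ b [ZMOD p])
  obtain ⟨x₀, hx₀, y₀, hy₀, hne, hxy⟩ := exists_eq_on_nonneg (isClosed_substShift τ)
    (fun x hx k => shiftPow_mem_substShift τ hx k) hinf
  choose g₁ hg₁ g₂ hg₂ t₁ t₂ ht hR₁ hR₂ using hpre
  let G : P → P := fun q => ⟨g₁ q.1 q.2, hg₁ q.1 q.2⟩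
  have hG : Function.Injective G := by
    intro q q' h
    have h1 : g₁ q.1 q.2 = g₁ q'.1 q'.2 := congrArg Subtype.val h
    have h2 := hR₁ q.1 q.2
    rw [h1] at h2
    exact Subtype.ext (hR _ _ _ _ _ h2 (hR₁ q'.1 q'.2)).2
  have hq₀ : (x₀ (-1), y₀ (-1)) ∈ P := ⟨x₀, hx₀, y₀, hy₀, -1, rfl, rfl, hne, hxy⟩
  -- `G` is onto the finite set P, so the second desubstitution of q₀ is the first one of some q';
  -- uniqueness of the last disagreement forces q' = q₀ and equal positions.
  obtain ⟨⟨q', hq'⟩, h⟩ := Finite.surjective_of_injective hG ⟨g₂ _ hq₀, hg₂ _ hq₀⟩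
  have h1 : g₁ q' hq' = g₂ _ hq₀ := congrArg Subtype.val h
  have h2 := hR₁ q' hq'
  rw [h1] at h2
  obtain ⟨h3, h4⟩ := hR _ _ _ _ _ h2 (hR₂ _ hq₀)
  subst h4
  exact ht _ _ h3

end Layers

/-! ### Digit expansions, carries, and the number k⁺ -/

section Expansion

variable {A : Type*} {p : ℕ} [NeZero p] {τ : A → Fin p → A}

/-- Every point of the subshift has exactly one desubstitution. -/
structure IsRecognizable (τ : A → Fin p → A) : Prop where
  injective : Function.Injective τ
  exists_mem_layer : ∀ x ∈ substShift τ, ∃ t : Fin p, x ∈ layer τ (t : ℕ)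
  emod_eq_of_mem_layer : ∀ (x : ℤ → A) (a b : ℤ), x ∈ layer τ a → x ∈ layer τ b → a % p = b % p

theorem IsRecognizable.digit_eq (hτ : IsRecognizable τ) {x : ℤ → A} {s t : Fin p}
    (hs : x ∈ layer τ (s : ℕ)) (ht : x ∈ layer τ (t : ℕ)) : s = t := by
  have h := hτ.emod_eq_of_mem_layer x _ _ hs ht
  rw [Int.emod_eq_of_lt (by omega) (by exact_mod_cast s.2),
    Int.emod_eq_of_lt (by omega) (by exact_mod_cast t.2)] at h
  exact Fin.ext (by exact_mod_cast h)

theorem IsExpansion.mem_layer {x : ℤ → A} {z : ℕ → ℤ → A} {δ : ℕ → Fin p}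
    (h : IsExpansion τ x z δ) (i : ℕ) : z i ∈ layer τ (δ i : ℕ) :=
  ⟨z (i + 1), h.2.1 _, h.2.2 i⟩

theorem IsRecognizable.exists_isExpansion (hτ : IsRecognizable τ) {x : ℤ → A}
    (hx : x ∈ substShift τ) :
    ∃ q : (ℕ → ℤ → A) × (ℕ → Fin p), IsExpansion τ x q.1 q.2 := by
  have h : ∀ x : substShift τ, ∃ (t : Fin p) (u : substShift τ),
      seqMap τ u.1 = shiftPow (-((t : ℕ) : ℤ)) x.1 := by
    rintro ⟨x, hx⟩
    obtain ⟨t, u, hu, h⟩ := hτ.exists_mem_layer x hx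
    exact ⟨t, ⟨u, hu⟩, h⟩
  choose t u htu using h
  refine ⟨(fun i => (u^[i] ⟨x, hx⟩).1, fun i => t (u^[i] ⟨x, hx⟩)), rfl, fun i => (u^[i] _).2,
    fun i => ?_⟩
  simp only
  rw [Function.iterate_succ_apply', htu]

theorem IsRecognizable.isExpansion_unique (hτ : IsRecognizable τ) {x : ℤ → A}
    {z w : ℕ → ℤ → A} {δ ε : ℕ → Fin p} (h : IsExpansion τ x z δ) (h' : IsExpansion τ x w ε) :
    z = w ∧ δ = ε := by
  have hz : ∀ i, z i = w i := by
    intro i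
    induction i with
    | zero => rw [h.1, h'.1]
    | succ i ih =>
      have h1 : δ i = ε i := hτ.digit_eq (h.mem_layer i) (ih ▸ h'.mem_layer i)
      apply seqMap_injective τ hτ.injective
      rw [h.2.2, h'.2.2, h1, ih]
  exact ⟨funext hz, funext fun i => hτ.digit_eq (h.mem_layer i) (hz i ▸ h'.mem_layer i)⟩

theorem IsRecognizable.isExpansion (hτ : IsRecognizable τ) {x : ℤ → A} (hx : x ∈ substShift τ) :
    IsExpansion τ x (desub τ x) (odometerMap τ x) := by
  have h := hτ.exists_isExpansion hx
  have h1 : expansion τ x = h.choose := dif_pos h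
  unfold desub odometerMap
  rw [h1]
  exact h.choose_spec

theorem IsExpansion.apply {x : ℤ → A} {z : ℕ → ℤ → A} {δ : ℕ → Fin p}
    (h : IsExpansion τ x z δ) (i : ℕ) (m : ℤ) :
    z i m = seqMap τ (z (i + 1)) (m + (δ i : ℕ)) := by
  rw [h.2.2 i]
  unfold shiftPow
  congr 1
  ring

theorem IsExpansion.apply_block {x : ℤ → A} {z : ℕ → ℤ → A} {δ : ℕ → Fin p}
    (h : IsExpansion τ x z δ) (i : ℕ) (m : ℤ) (t : Fin p) :
    z i (p * m + (t : ℕ) - (δ i : ℕ)) = τ (z (i + 1) m) t := by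
  rw [h.apply, sub_add_cancel, seqMap_apply]

/-- The carries of the addition of the integer `k` to the digit sequence `δ`. -/
def carry (δ : ℕ → Fin p) (k : ℤ) : ℕ → ℤ
  | 0 => k
  | i + 1 => (carry δ k i + (δ i : ℕ)) / p

/-- The digits of the sum of the integer `k` and the point `δ` of the odometer. -/
def addDigits (δ : ℕ → Fin p) (k : ℤ) (i : ℕ) : Fin p :=
  Fin.ofNat p ((carry δ k i + (δ i : ℕ)) % p).toNat

theorem mul_carry_add_addDigits (δ : ℕ → Fin p) (k : ℤ) (i : ℕ) :
    p * carry δ k (i + 1) + (addDigits δ k i : ℕ) = carry δ k i + (δ i : ℕ) := by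
  have hp : (0 : ℤ) < p := by exact_mod_cast Nat.pos_of_ne_zero (NeZero.ne p)
  have h1 := Int.emod_nonneg (carry δ k i + (δ i : ℕ)) hp.ne'
  have h2 := Int.emod_lt_of_pos (carry δ k i + (δ i : ℕ)) hp
  have h3 := Int.mul_ediv_add_emod (carry δ k i + (δ i : ℕ)) p
  have h4 : ((addDigits δ k i : ℕ) : ℤ) = (carry δ k i + (δ i : ℕ)) % p := by
    unfold addDigits
    rw [Fin.val_ofNat, Nat.mod_eq_of_lt (by omega), Int.toNat_of_nonneg h1]
  rw [h4]
  exact h3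

/-- From τ T^c = T^(pc) τ and division with remainder by p at each level; thus π(T^k x) = π(x) + k.
-/
theorem IsExpansion.shiftPow {x : ℤ → A} {z : ℕ → ℤ → A} {δ : ℕ → Fin p}
    (h : IsExpansion τ x z δ) (k : ℤ) :
    IsExpansion τ (shiftPow k x) (fun i => shiftPow (carry δ k i) (z i)) (addDigits δ k) := by
  refine ⟨by simp only [carry, h.1], fun i => shiftPow_mem_substShift τ (h.2.1 i) _, fun i => ?_⟩
  simp only
  rw [seqMap_shiftPow, h.2.2, shiftPow_add, shiftPow_add]
  congr 1
  have := mul_carry_add_addDigits δ k i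
  omega

theorem IsRecognizable.odometerMap_shiftPow (hτ : IsRecognizable τ) {x : ℤ → A}
    (hx : x ∈ substShift τ) (k : ℤ) :
    odometerMap τ (shiftPow k x) = addDigits (odometerMap τ x) k :=
  (hτ.isExpansion_unique (hτ.isExpansion (shiftPow_mem_substShift τ hx k))
    ((hτ.isExpansion hx).shiftPow k)).2

theorem mem_iPlus (x : ℤ → A) (i : ℕ) : i ∈ iPlus τ x ↔ (odometerMap τ x i : ℕ) + 1 < p := by
  have := (odometerMap τ x i).2
  simp only [iPlus, sWord, Set.mem_ofPred_eq, length_subword]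
  omega

theorem iPlus_congr {x y : ℤ → A} (h : odometerMap τ x = odometerMap τ y) :
    iPlus τ x = iPlus τ y := by
  ext i
  rw [mem_iPlus, mem_iPlus, h]

theorem infinite_iPlus_iff (x : ℤ → A) :
    (iPlus τ x).Infinite ↔ ∃ᶠ i in atTop, (odometerMap τ x i : ℕ) + 1 < p := by
  rw [Nat.frequently_atTop_iff_infinite]
  have : iPlus τ x = {i | (odometerMap τ x i : ℕ) + 1 < p} := Set.ext fun i => mem_iPlus x i
  rw [this]

/-- The length of `x_0 s_0(x) τ(s_1(x)) ⋯ τ^(n-1)(s_(n-1)(x))` as a function of the digits. -/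
def rightLength (δ : ℕ → Fin p) (n : ℕ) : ℕ :=
  1 + ∑ j ∈ Finset.range n, (p - 1 - (δ j : ℕ)) * p ^ j

theorem length_rightWord (x : ℤ → A) (i : ℕ) :
    (rightWord τ x i).length = rightLength (odometerMap τ x) (i + 1) := by
  have h : ∀ n, ((List.range n).flatMap fun j => (wordMap τ)^[j] (sWord τ x j)).length =
      ∑ j ∈ Finset.range n, (p - 1 - (odometerMap τ x j : ℕ)) * p ^ j := by
    intro n
    induction n with
    | zero => simp
    | succ n ih =>
      rw [List.range_succ, List.flatMap_append, List.length_append, ih, Finset.sum_range_succ]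
      simp [length_wordMap_iterate, sWord]
  rw [rightWord, List.length_cons, h, rightLength, add_comm]

theorem kPlus_congr {x y : ℤ → A} (h : odometerMap τ x = odometerMap τ y) :
    kPlus τ x = kPlus τ y := by
  simp only [kPlus, length_rightWord, h, iPlus_congr h]

/-- The lengths are nondecreasing and grow only at indices of I⁺; the inserted 1 covers empty I⁺. -/
theorem kPlus_eq_rightLength (x : ℤ → A) (N : ℕ) (hN : ∀ i ∈ iPlus τ x, i < N) :
    kPlus τ x = rightLength (odometerMap τ x) N := by
  have hmono : Monotone (rightLength (odometerMap τ x)) := by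
    refine monotone_nat_of_le_succ fun n => ?_
    unfold rightLength
    rw [Finset.sum_range_succ]
    omega
  unfold kPlus
  refine IsGreatest.csSup_eq ⟨?_, ?_⟩
  · clear hN
    induction N with
    | zero => simp [rightLength]
    | succ n ih =>
      by_cases hn : n ∈ iPlus τ x
      · exact Or.inr ⟨n, hn, (length_rightWord x n).symm⟩
      · rw [mem_iPlus] at hn
        have h1 : rightLength (odometerMap τ x) (n + 1) = rightLength (odometerMap τ x) n := by
          unfold rightLength
          rw [Finset.sum_range_succ, show p - 1 - (odometerMap τ x n : ℕ) = 0 by omega]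
          simp
        rwa [h1]
  · rintro n (rfl | ⟨i, hi, rfl⟩)
    · unfold rightLength
      omega
    · rw [length_rightWord]
      exact hmono (hN i hi)

theorem carry_eq (δ : ℕ → Fin p) (k : ℤ) (n : ℕ) :
    carry δ k n = (k + ∑ j ∈ Finset.range n, (δ j : ℕ) * (p : ℤ) ^ j) / p ^ n := by
  have hp : (0 : ℤ) < p := by exact_mod_cast Nat.pos_of_ne_zero (NeZero.ne p)
  induction n with
  | zero => simp [carry]
  | succ n ih =>
    rw [carry, ih, Finset.sum_range_succ, ← add_assoc, pow_succ,
      ← Int.ediv_ediv_of_nonneg (by positivity), Int.add_mul_ediv_right _ _ (by positivity)]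

omit [NeZero p] in
theorem rightLength_add (δ : ℕ → Fin p) (n : ℕ) :
    (rightLength δ n : ℤ) + ∑ j ∈ Finset.range n, (δ j : ℕ) * (p : ℤ) ^ j = p ^ n := by
  induction n with
  | zero => simp [rightLength]
  | succ n ih =>
    have h := (δ n).2
    unfold rightLength at ih ⊢
    rw [Finset.sum_range_succ, Finset.sum_range_succ, pow_succ]
    push_cast at ih ⊢
    rw [show ((p - 1 - (δ n : ℕ) : ℕ) : ℤ) = p - 1 - (δ n : ℕ) by omega]
    linear_combination ih

/-- By `rightLength_add`, adding k⁺ to the digits before N gives exactly p^N, so the carry into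
place N is 1. The remaining digits are p-1: the carry persists and they become 0. -/
theorem IsRecognizable.infinite_iPlus_shiftPow_kPlus (hτ : IsRecognizable τ) (hp : 2 ≤ p)
    {x : ℤ → A} (hx : x ∈ substShift τ) (hfin : (iPlus τ x).Finite) :
    (iPlus τ (shiftPow (kPlus τ x) x)).Infinite := by
  obtain ⟨M, hM⟩ := hfin.bddAbove
  have hN : ∀ i ∈ iPlus τ x, i < M + 1 := fun i hi => Nat.lt_succ_of_le (hM hi)
  have hlast : ∀ i, M + 1 ≤ i → ((odometerMap τ x i : ℕ) : ℤ) = p - 1 := by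
    intro i hi
    have h1 : i ∉ iPlus τ x := fun h => absurd (hN i h) (by omega)
    have h2 := (odometerMap τ x i).2
    rw [mem_iPlus] at h1
    omega
  have hp' : (p : ℤ) ≠ 0 := by omega
  have hc : ∀ i, M + 1 ≤ i → carry (odometerMap τ x) (kPlus τ x) i = 1 := by
    intro i hi
    induction i, hi using Nat.le_induction with
    | base =>
      rw [carry_eq, kPlus_eq_rightLength x _ hN, rightLength_add, Int.ediv_self (by positivity)]
    | succ i hi ih =>
      rw [carry, ih, hlast i hi, show (1 : ℤ) + (p - 1) = p by ring, Int.ediv_self hp']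
  rw [infinite_iPlus_iff, hτ.odometerMap_shiftPow hx]
  refine Eventually.frequently ?_
  filter_upwards [eventually_ge_atTop (M + 1)] with i hi
  have h := mul_carry_add_addDigits (odometerMap τ x) (kPlus τ x) i
  rw [hc i hi, hc (i + 1) (by omega), hlast i hi] at h
  omega

/-- The carries of a nonnegative k drop to at most 1, and a digit below p-1 absorbs a carry 1. From
there on the digits are unchanged. -/
theorem IsRecognizable.infinite_iPlus_shiftPow (hτ : IsRecognizable τ) (hp : 2 ≤ p)
    {x : ℤ → A} (hx : x ∈ substShift τ) (hinf : (iPlus τ x).Infinite) (k : ℕ) :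
    (iPlus τ (shiftPow k x)).Infinite := by
  rw [infinite_iPlus_iff] at hinf ⊢
  rw [hτ.odometerMap_shiftPow hx]
  set δ := odometerMap τ x
  have hp' : (2 : ℤ) ≤ p := by exact_mod_cast hp
  have hlt : ∀ i, ((δ i : ℕ) : ℤ) < p := fun i => by exact_mod_cast (δ i).2
  have hnonneg : ∀ i, 0 ≤ carry δ k i := by
    intro i
    induction i with
    | zero => simp [carry]
    | succ i ih =>
      rw [carry]
      exact Int.ediv_nonneg (by omega) (by omega)
  have hstep : ∀ i, carry δ k i ≤ 1 → carry δ k (i + 1) ≤ 1 := by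
    intro i hi
    rw [carry]
    have h2 : carry δ k i + (δ i : ℕ) < 2 * p := by have := hlt i; omega
    have := Int.ediv_lt_of_lt_mul (by omega) h2
    omega
  have hle : ∀ i, carry δ k i ≤ 1 ∨ carry δ k i ≤ (k : ℤ) - i := by
    intro i
    induction i with
    | zero => right; simp [carry]
    | succ i ih =>
      by_cases h : carry δ k i ≤ 1
      · exact Or.inl (hstep i h)
      · right
        have h1 := ih.resolve_left h
        have h2 : carry δ k (i + 1) < carry δ k i := by
          rw [carry]
          apply Int.ediv_lt_of_lt_mul (by omega)
          have := hlt i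
          nlinarith
        push_cast
        omega
  have hle1 : ∀ i, k ≤ i → carry δ k i ≤ 1 := by
    intro i hi
    rcases hle i with h | h <;> omega
  have hzero : ∃ M, carry δ k M = 0 := by
    by_contra hcon
    push Not at hcon
    obtain ⟨i, hi, hδ⟩ := (frequently_atTop.1 hinf) k
    have h1 : ∀ j, k ≤ j → carry δ k j = 1 := by
      intro j hj
      have := hle1 j hj
      have := hnonneg j
      have := hcon j
      omega
    have h := mul_carry_add_addDigits δ k i
    rw [h1 i hi, h1 (i + 1) (by omega)] at h
    omega
  obtain ⟨M, hM⟩ := hzero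
  have hM' : ∀ i, M ≤ i → carry δ k i = 0 := by
    intro i hi
    induction i, hi using Nat.le_induction with
    | base => exact hM
    | succ i hi ih =>
      rw [carry, ih, zero_add]
      exact Int.ediv_eq_zero_of_lt (by omega) (hlt i)
  refine (hinf.and_eventually (eventually_ge_atTop M)).mono fun i hi => ?_
  have h := mul_carry_add_addDigits δ k i
  rw [hM' i hi.2, hM' (i + 1) (by omega)] at h
  have := hi.1
  omega

end Expansion

/-! ### Asymptotic, distal and proximal pairs in coordinates -/

section Dist

variable {A : Type*}

open scoped Classical in
theorem seqDist_le {x y : ℤ → A} {N : ℕ} (h : ∀ i : ℤ, i.natAbs < N → x i = y i) :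
    seqDist x y ≤ (1 / 2 : ℝ) ^ N := by
  unfold seqDist
  split_ifs with hxy
  · positivity
  · refine pow_le_pow_of_le_one (by norm_num) (by norm_num) ?_
    obtain ⟨i, hi⟩ := Function.ne_iff.1 hxy
    refine le_csInf ⟨_, i, rfl, hi⟩ ?_
    rintro n ⟨j, rfl, hj⟩
    by_contra hlt
    exact hj (h j (by omega))

open scoped Classical in
theorem le_seqDist {x y : ℤ → A} {i : ℤ} (h : x i ≠ y i) :
    (1 / 2 : ℝ) ^ i.natAbs ≤ seqDist x y := by
  unfold seqDist
  rw [if_neg (fun hxy => h (congrFun hxy i))]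
  exact pow_le_pow_of_le_one (by norm_num) (by norm_num) (Nat.sInf_le ⟨i, rfl, h⟩)

theorem seqDist_nonneg (x y : ℤ → A) : 0 ≤ seqDist x y := by
  unfold seqDist
  split_ifs <;> positivity

theorem seqDist_le_one (x y : ℤ → A) : seqDist x y ≤ 1 := by
  simpa using seqDist_le (x := x) (y := y) (N := 0) (by simp)

theorem mem_asymptoticPairs_iff {X : Set (ℤ → A)} {x y : ℤ → A} (hx : x ∈ X) (hy : y ∈ X) :
    (x, y) ∈ asymptoticPairs X seqDist shift ↔ ∃ M : ℤ, ∀ m, M ≤ m → x m = y m := by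
  simp only [asymptoticPairs, Set.mem_ofPred_eq, hx, hy, true_and, shift_iterate]
  constructor
  · intro h
    obtain ⟨M, hM⟩ := eventually_atTop.1 (h.eventually_lt_const (zero_lt_one))
    refine ⟨M, fun m hm => ?_⟩
    by_contra hne
    have h1 := hM m.toNat (by omega)
    have h2 : shiftPow (m.toNat : ℤ) x 0 ≠ shiftPow (m.toNat : ℤ) y 0 := by
      simpa [shiftPow, Int.toNat_of_nonneg (show 0 ≤ m by omega)] using hne
    have h3 := le_seqDist h2
    rw [Int.natAbs_zero, pow_zero] at h3
    linarith
  · rintro ⟨M, hM⟩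
    have h1 : Tendsto (fun n : ℕ => (1 / 2 : ℝ) ^ (n - M.toNat)) atTop (𝓝 0) :=
      (tendsto_pow_atTop_nhds_zero_of_lt_one (by norm_num) (by norm_num)).comp
        (tendsto_sub_atTop_nat M.toNat)
    refine squeeze_zero (fun n => seqDist_nonneg _ _) (fun n => ?_) h1
    refine seqDist_le fun i hi => ?_
    exact hM _ (by omega)

theorem mem_distalPairs_of_forall_ne {X : Set (ℤ → A)} {x y : ℤ → A} (hx : x ∈ X) (hy : y ∈ X)
    {M : ℤ} (h : ∀ m, M ≤ m → x m ≠ y m) : (x, y) ∈ distalPairs X seqDist shift := by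
  refine ⟨hx, hy, ?_⟩
  simp only [shift_iterate]
  have h1 : (fun n : ℕ => seqDist (shiftPow n x) (shiftPow n y)) =ᶠ[atTop] fun _ => (1 : ℝ) := by
    filter_upwards [eventually_ge_atTop M.toNat] with n hn
    refine le_antisymm (seqDist_le_one _ _) ?_
    have h2 : shiftPow (n : ℤ) x 0 ≠ shiftPow (n : ℤ) y 0 := h _ (by omega)
    simpa using le_seqDist h2
  rw [liminf_congr h1, liminf_const]
  exact one_pos

theorem exists_forall_eq_of_mem_proximalPairs {X : Set (ℤ → A)} {x y : ℤ → A}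
    (h : (x, y) ∈ proximalPairs X seqDist shift) (N : ℕ) :
    ∃ m : ℤ, ∀ i : ℤ, i.natAbs ≤ N → x (m + i) = y (m + i) := by
  have h1 := h.2.2
  simp only [shift_iterate] at h1
  have h2 : ∃ᶠ n : ℕ in atTop, seqDist (shiftPow n x) (shiftPow n y) < (1 / 2 : ℝ) ^ N := by
    refine frequently_lt_of_liminf_lt ?_ (by rw [h1]; positivity)
    -- Over ℝ the liminf is meaningful only for bounded functions.
    exact (isBoundedUnder_of ⟨1, fun n => seqDist_le_one _ _⟩).isCoboundedUnder_ge
  obtain ⟨n, hn⟩ := h2.exists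
  refine ⟨n, fun i hi => ?_⟩
  by_contra hne
  have h3 : shiftPow (n : ℤ) x i ≠ shiftPow (n : ℤ) y i := by
    simpa [shiftPow, add_comm] using hne
  have h4 := le_seqDist h3
  have h5 : (1 / 2 : ℝ) ^ N ≤ (1 / 2 : ℝ) ^ i.natAbs :=
    pow_le_pow_of_le_one (by norm_num) (by norm_num) hi
  linarith

end Dist

/-! ### Pairs in one fibre of π, and Li–Yorke pairs -/

section Fibre

variable {A : Type*} {p : ℕ} [NeZero p] {τ : A → Fin p → A}

omit [NeZero p] in
-- Passing to the next level strictly decreases a position m ≥ 2; position 1 stays at 1 while the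
-- digit is p-1 and drops to 0 otherwise. Digits below p-1 recur, so the descent ends.
theorem carry_induction (hp : 2 ≤ p) {δ : ℕ → Fin p} (hδ : ∃ᶠ i in atTop, (δ i : ℕ) + 1 < p)
    {P : ℕ → ℤ → Prop} {N : ℕ}
    (h0 : ∀ n m, N ≤ n → 1 ≤ m → (m + (δ n : ℕ)) / (p : ℤ) = 0 → P n m)
    (h1 : ∀ n m, N ≤ n → 1 ≤ m → P (n + 1) ((m + (δ n : ℕ)) / p) → P n m)
    {n : ℕ} {m : ℤ} (hn : N ≤ n) (hm : 1 ≤ m) : P n m := by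
  have hp' : (2 : ℤ) ≤ p := by exact_mod_cast hp
  have hlt : ∀ i, ((δ i : ℕ) : ℤ) < p := fun i => by exact_mod_cast (δ i).2
  have hone : ∀ d n, N ≤ n → (δ (n + d) : ℕ) + 1 < p → P n 1 := by
    intro d
    induction d with
    | zero =>
      intro n hn h
      exact h0 n 1 hn le_rfl (Int.ediv_eq_zero_of_lt (by omega) (by simp at h; omega))
    | succ d ih =>
      intro n hn h
      by_cases hd : (δ n : ℕ) + 1 < p
      · exact h0 n 1 hn le_rfl (Int.ediv_eq_zero_of_lt (by omega) (by omega))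
      · apply h1 n 1 hn le_rfl
        rw [show (1 : ℤ) + (δ n : ℕ) = p by have := hlt n; omega, Int.ediv_self (by omega)]
        exact ih (n + 1) (by omega) (by rwa [show n + 1 + d = n + (d + 1) by ring])
  have hall : ∀ M : ℕ, ∀ m : ℤ, 1 ≤ m → m ≤ M → ∀ n, N ≤ n → P n m := by
    intro M
    induction M with
    | zero => intro m h h'; simp at h'; omega
    | succ M ih =>
      intro m hm hM n hn
      by_cases hm1 : m = 1
      · subst hm1
        obtain ⟨i, hi, h⟩ := frequently_atTop.1 hδ n
        exact hone (i - n) n hn (by rwa [Nat.add_sub_cancel' hi])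
      · have h2 : (m + (δ n : ℕ)) / (p : ℤ) < m := by
          apply Int.ediv_lt_of_lt_mul (by omega)
          have := hlt n
          have h2m : 2 ≤ m := by omega
          nlinarith [mul_nonneg (sub_nonneg.2 h2m) (sub_nonneg.2 hp')]
        have h3 : 0 ≤ (m + (δ n : ℕ)) / (p : ℤ) := Int.ediv_nonneg (by omega) (by omega)
        by_cases h4 : (m + (δ n : ℕ)) / (p : ℤ) = 0
        · exact h0 n m hn hm h4
        · exact h1 n m hn hm (ih _ (by omega) (by push_cast at hM; omega) _ (by omega))
  exact hall m.toNat m hm (by omega) n hn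

variable {x y : ℤ → A} {z w : ℕ → ℤ → A} {δ : ℕ → Fin p}

theorem IsExpansion.apply_eq (hz : IsExpansion τ x z δ) (hw : IsExpansion τ y w δ) {n : ℕ} {m : ℤ}
    (h : z (n + 1) ((m + (δ n : ℕ)) / p) = w (n + 1) ((m + (δ n : ℕ)) / p)) :
    z n m = w n m := by
  rw [hz.apply, hw.apply]
  simp only [seqMap, h]

theorem IsExpansion.apply_ne (hz : IsExpansion τ x z δ) (hw : IsExpansion τ y w δ)
    (hτ : ¬ HasCoincidence τ) {n : ℕ} {m : ℤ}
    (h : z (n + 1) ((m + (δ n : ℕ)) / p) ≠ w (n + 1) ((m + (δ n : ℕ)) / p)) :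
    z n m ≠ w n m := by
  rw [hz.apply, hw.apply]
  intro h1
  exact hτ ⟨_, _, h, _, h1⟩

theorem IsExpansion.eq_of_le_zero (hz : IsExpansion τ x z δ) (hw : IsExpansion τ y w δ) (n : ℕ)
    (h : ∃ M : ℤ, ∀ m, M ≤ m → z n m = w n m) : ∃ M : ℤ, ∀ m, M ≤ m → x m = y m := by
  have hp : (0 : ℤ) < p := by exact_mod_cast Nat.pos_of_ne_zero (NeZero.ne p)
  induction n with
  | zero => rwa [hz.1, hw.1] at h
  | succ n ih =>
    obtain ⟨M, hM⟩ := h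
    refine ih ⟨p * M, fun m hm => hz.apply_eq hw (hM _ ?_)⟩
    rw [Int.le_ediv_iff_mul_le hp, mul_comm]
    omega

/-- As δ_n < p, coordinate 0 of level n comes from coordinate 0 of level n+1, so the disagreement at
0 climbs through all levels. Absence of coincidences then carries it down to every m > 0. -/
theorem IsExpansion.forall_ne (hp : 2 ≤ p) (hz : IsExpansion τ x z δ) (hw : IsExpansion τ y w δ)
    (hτ : ¬ HasCoincidence τ) (hδ : ∃ᶠ i in atTop, (δ i : ℕ) + 1 < p) (h0 : x 0 ≠ y 0) {m : ℤ}
    (hm : 0 ≤ m) : x m ≠ y m := by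
  have hlt : ∀ i, ((δ i : ℕ) : ℤ) < p := fun i => by exact_mod_cast (δ i).2
  have h1 : ∀ n, z n 0 ≠ w n 0 := by
    intro n
    induction n with
    | zero => rwa [hz.1, hw.1]
    | succ n ih =>
      intro h
      refine ih (hz.apply_eq hw ?_)
      rwa [zero_add, Int.ediv_eq_zero_of_lt (by omega) (hlt n)]
  rcases hm.eq_or_lt with rfl | hm
  · exact h0
  · have h2 : z 0 m ≠ w 0 m := by
      refine carry_induction hp hδ (P := fun n m => z n m ≠ w n m) (N := 0) ?_ ?_ le_rfl hm
      · intro n m _ _ h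
        exact hz.apply_ne hw hτ (by rw [h]; exact h1 _)
      · intro n m _ _ h
        exact hz.apply_ne hw hτ h
    rwa [hz.1, hw.1] at h2

theorem IsExpansion.eq_on_pos_of_subword_eq (hp : 2 ≤ p) (hz : IsExpansion τ x z δ)
    (hw : IsExpansion τ y w δ) (hδ : ∃ᶠ i in atTop, (δ i : ℕ) + 1 < p) {N : ℕ}
    (h : ∀ n, N ≤ n →
      subword (z n) 1 (p - 1 - (δ n : ℕ)) = subword (w n) 1 (p - 1 - (δ n : ℕ)))
    {m : ℤ} (hm : 1 ≤ m) : z N m = w N m := by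
  refine carry_induction hp hδ (P := fun n m => z n m = w n m) (N := N) ?_ ?_ le_rfl hm
  · intro n m hn hm h0
    -- Quotient 0 means m ≤ p-1-δ_n, so m is letter number m-1 of s_n.
    have h1 := (subword_eq_iff _ _ _ _ _).1 (h n hn) (m - 1).toNat (by
      have h2 := Int.lt_ediv_add_one_mul_self (m + (δ n : ℕ)) (show (0 : ℤ) < p by omega)
      rw [h0, zero_add, one_mul] at h2
      omega)
    rwa [show (1 : ℤ) + ((m - 1).toNat : ℤ) = m by omega] at h1
  · intro n m _ _ h
    exact hz.apply_eq hw h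

theorem IsExpansion.eq_succ_of_eq (hinj : Function.Injective τ) (hz : IsExpansion τ x z δ)
    (hw : IsExpansion τ y w δ) {n : ℕ} {M M' : ℤ} (h : ∀ m, M ≤ m → z n m = w n m)
    (hM : M ≤ p * M' - (δ n : ℕ)) : ∀ m, M' ≤ m → z (n + 1) m = w (n + 1) m := by
  intro m hm
  apply hinj
  funext t
  rw [← hz.apply_block, ← hw.apply_block]
  apply h
  have : (p : ℤ) * M' ≤ p * m := by gcongr
  omega

/-- Lifting by `IsExpansion.eq_succ_of_eq` lowers the start of the common tail to 2. It moves from 2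
to 1 at a digit below p-1, as this requires 2 ≤ p - δ_n, and then stays there. -/
theorem IsExpansion.eventually_eq_on_pos (hp : 2 ≤ p) (hinj : Function.Injective τ)
    (hz : IsExpansion τ x z δ) (hw : IsExpansion τ y w δ)
    (hδ : ∃ᶠ i in atTop, (δ i : ℕ) + 1 < p) (h : ∃ M : ℤ, ∀ m, M ≤ m → x m = y m) :
    ∀ᶠ n in atTop, ∀ m, 1 ≤ m → z n m = w n m := by
  have hp' : (2 : ℤ) ≤ p := by exact_mod_cast hp
  have hlt : ∀ i, ((δ i : ℕ) : ℤ) < p := fun i => by exact_mod_cast (δ i).2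
  have htwo : ∀ M n : ℕ, (∀ m : ℤ, M + 2 ≤ m → z n m = w n m) →
      ∃ n', ∀ m : ℤ, 2 ≤ m → z n' m = w n' m := by
    intro M
    induction M with
    | zero => intro n h; exact ⟨n, by simpa using h⟩
    | succ M ih =>
      intro n h
      refine ih (n + 1) (hz.eq_succ_of_eq hinj hw h ?_)
      have := hlt n
      push_cast
      nlinarith
  obtain ⟨M, hM⟩ := h
  obtain ⟨n₁, h₁⟩ := htwo M.toNat 0 (by
    intro m hm
    rw [hz.1, hw.1]
    exact hM m (by omega))
  have h₂ : ∀ n, n₁ ≤ n → ∀ m : ℤ, 2 ≤ m → z n m = w n m := by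
    intro n hn
    induction n, hn using Nat.le_induction with
    | base => exact h₁
    | succ n hn ih =>
      refine hz.eq_succ_of_eq hinj hw ih ?_
      have := hlt n
      omega
  obtain ⟨n₂, hn₂, hδ₂⟩ := frequently_atTop.1 hδ n₁
  refine eventually_atTop.2 ⟨n₂ + 1, fun n hn => ?_⟩
  induction n, hn using Nat.le_induction with
  | base =>
    refine hz.eq_succ_of_eq hinj hw (h₂ n₂ hn₂) ?_
    omega
  | succ n hn ih =>
    refine hz.eq_succ_of_eq hinj hw ih ?_
    have := hlt n
    omega

theorem IsRecognizable.exists_forall_eq_iff (hτ : IsRecognizable τ) (hp : 2 ≤ p)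
    (hx : x ∈ substShift τ) (hy : y ∈ substShift τ) (hxy : odometerMap τ x = odometerMap τ y)
    (hinf : (iPlus τ x).Infinite) :
    (∃ M : ℤ, ∀ m, M ≤ m → x m = y m) ↔ ∀ᶠ i in atTop, sWord τ x i = sWord τ y i := by
  have hz := hτ.isExpansion hx
  have hw := hτ.isExpansion hy
  rw [← hxy] at hw
  rw [infinite_iPlus_iff] at hinf
  unfold sWord
  rw [← hxy]
  constructor
  · intro h
    filter_upwards [hz.eventually_eq_on_pos hp hτ.injective hw hinf h] with n hn
    rw [subword_eq_iff]
    intro j _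
    exact hn _ (by omega)
  · intro h
    obtain ⟨N, hN⟩ := eventually_atTop.1 h
    exact hz.eq_of_le_zero hw N ⟨1, fun m hm => hz.eq_on_pos_of_subword_eq hp hw hinf hN hm⟩

theorem IsRecognizable.odometerMap_shiftPow_congr (hτ : IsRecognizable τ)
    (hx : x ∈ substShift τ) (hy : y ∈ substShift τ) (hxy : odometerMap τ x = odometerMap τ y)
    (k : ℤ) : odometerMap τ (shiftPow k x) = odometerMap τ (shiftPow k y) := by
  rw [hτ.odometerMap_shiftPow hx, hτ.odometerMap_shiftPow hy, hxy]

theorem exists_forall_eq_shiftPow_iff (k : ℤ) :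
    (∃ M : ℤ, ∀ m, M ≤ m → shiftPow k x m = shiftPow k y m) ↔
      ∃ M : ℤ, ∀ m, M ≤ m → x m = y m := by
  constructor
  · rintro ⟨M, hM⟩
    refine ⟨M + k, fun m hm => ?_⟩
    simpa [shiftPow] using hM (m - k) (by omega)
  · rintro ⟨M, hM⟩
    exact ⟨M - k, fun m hm => hM _ (by omega)⟩

theorem IsRecognizable.mem_asymptoticPairs_iff (hτ : IsRecognizable τ) (hp : 2 ≤ p)
    (hx : x ∈ substShift τ) (hy : y ∈ substShift τ) (hxy : odometerMap τ x = odometerMap τ y) :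
    (x, y) ∈ asymptoticPairs (substShift τ) seqDist shift ↔
      ((iPlus τ x).Infinite ∧ ∀ᶠ i : ℕ in atTop, sWord τ x i = sWord τ y i) ∨
      ((iPlus τ x).Finite ∧ ∀ᶠ i : ℕ in atTop,
        sWord τ (shiftPow (kPlus τ x) x) i = sWord τ (shiftPow (kPlus τ x) y) i) := by
  rw [Subst.mem_asymptoticPairs_iff hx hy]
  by_cases hfin : (iPlus τ x).Finite
  · rw [← hτ.exists_forall_eq_iff hp (shiftPow_mem_substShift τ hx _)
      (shiftPow_mem_substShift τ hy _) (hτ.odometerMap_shiftPow_congr hx hy hxy _)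
      (hτ.infinite_iPlus_shiftPow_kPlus hp hx hfin), exists_forall_eq_shiftPow_iff]
    simp [hfin, Set.Infinite]
  · rw [hτ.exists_forall_eq_iff hp hx hy hxy hfin]
    simp [hfin, Set.Infinite]

theorem IsRecognizable.mem_distalPairs (hτ : IsRecognizable τ) (hp : 2 ≤ p)
    (hcoinc : ¬ HasCoincidence τ) (hx : x ∈ substShift τ) (hy : y ∈ substShift τ)
    (hxy : odometerMap τ x = odometerMap τ y) {i : ℤ} (hi : x i ≠ y i)
    (hinf : (iPlus τ (shiftPow i x)).Infinite) :
    (x, y) ∈ distalPairs (substShift τ) seqDist shift := by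
  have hz := hτ.isExpansion (shiftPow_mem_substShift τ hx i)
  have hw := hτ.isExpansion (shiftPow_mem_substShift τ hy i)
  rw [← hτ.odometerMap_shiftPow_congr hx hy hxy] at hw
  rw [infinite_iPlus_iff] at hinf
  refine mem_distalPairs_of_forall_ne hx hy (M := i) fun m hm => ?_
  have h := hz.forall_ne hp hw hcoinc hinf (by simpa [shiftPow] using hi)
    (m := m - i) (by omega)
  simpa [shiftPow] using h

/-- Some shift T^k x has infinite I⁺, and this persists for all larger shifts; so no disagreement is
allowed from k on. -/
theorem IsRecognizable.mem_asymptoticPairs (hτ : IsRecognizable τ) (hp : 2 ≤ p)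
    (hx : x ∈ substShift τ) (hy : y ∈ substShift τ)
    (h : ¬ ∃ i : ℤ, x i ≠ y i ∧ (iPlus τ (shiftPow i x)).Infinite) :
    (x, y) ∈ asymptoticPairs (substShift τ) seqDist shift := by
  have hk : ∃ k : ℤ, (iPlus τ (shiftPow k x)).Infinite := by
    by_cases hfin : (iPlus τ x).Finite
    · exact ⟨_, hτ.infinite_iPlus_shiftPow_kPlus hp hx hfin⟩
    · exact ⟨0, by rwa [shiftPow_zero]⟩
  obtain ⟨k, hk⟩ := hk
  rw [Subst.mem_asymptoticPairs_iff hx hy]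
  refine ⟨k, fun m hm => ?_⟩
  by_contra hne
  refine h ⟨m, hne, ?_⟩
  have := hτ.infinite_iPlus_shiftPow hp (shiftPow_mem_substShift τ hx k) hk (m - k).toNat
  rwa [shiftPow_add, show ((m - k).toNat : ℤ) + k = m by omega] at this

/-- Proximal points of the subshift have the same digits. -/
theorem IsRecognizable.odometerMap_eq_of_proximal [Finite A] (hτ : IsRecognizable τ)
    (hx : x ∈ substShift τ) (hy : y ∈ substShift τ)
    (h : ∀ N : ℕ, ∃ m : ℤ, ∀ i : ℤ, i.natAbs ≤ N → x (m + i) = y (m + i)) :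
    odometerMap τ x = odometerMap τ y := by
  let _ : TopologicalSpace A := ⊥
  have : DiscreteTopology A := ⟨rfl⟩
  have hz := hτ.isExpansion hx
  have hw := hτ.isExpansion hy
  set δ := odometerMap τ x
  set ε := odometerMap τ y
  have hdigit : ∀ (u v : ℤ → A) (s t : Fin p), u ∈ layer τ (s : ℕ) → v ∈ layer τ (t : ℕ) →
      (∀ N : ℕ, ∃ m : ℤ, ∀ i : ℤ, i.natAbs ≤ N → u (m + i) = v (m + i)) → s = t := by
    intro u v s t hu hv huv
    -- The pairs whose phases differ by t - s form a closed set, stable under common shifts.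
    -- Proximality produces a diagonal point in it, and recognizability gives s ≡ t.
    have hK : IsClosed (⋃ r : Fin p,
        layer τ (r : ℕ) ×ˢ layer τ ((r : ℕ) + (((t : ℕ) : ℤ) - (s : ℕ)))) :=
      isClosed_iUnion_of_finite fun r => (isClosed_layer τ _).prod (isClosed_layer τ _)
    obtain ⟨q, hq, hqq⟩ := exists_mem_forall_eq_of_isClosed hK
      (fun N => {i : ℤ | i.natAbs ≤ N}) (fun M N hMN i hi => le_trans hi hMN)
      (fun N => by
        obtain ⟨m, hm⟩ := huv N
        refine ⟨(shiftPow m u, shiftPow m v), ?_, fun i hi => ?_⟩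
        · obtain ⟨r, hr⟩ := exists_block (p := p) ((s : ℕ) + m)
          refine Set.mem_iUnion.2 ⟨r, ?_, ?_⟩
          · rw [← layer_add_mul τ _ (((s : ℕ) + m) / p), add_comm, ← hr]
            exact shiftPow_mem_layer τ hu m
          · rw [← layer_add_mul τ _ (((s : ℕ) + m) / p)]
            convert shiftPow_mem_layer τ hv m using 2
            omega
        · simpa [shiftPow, add_comm] using hm i hi)
    have hqe : q.1 = q.2 := funext fun i => hqq i.natAbs i (le_refl i.natAbs)
    obtain ⟨r, hr1, hr2⟩ := Set.mem_iUnion.1 hq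
    rw [← hqe] at hr2
    have h1 : ((r : ℕ) : ℤ) ≡ (r : ℕ) + (((t : ℕ) : ℤ) - (s : ℕ)) [ZMOD p] :=
      hτ.emod_eq_of_mem_layer _ _ _ hr1 hr2
    have h2 : ((s : ℕ) : ℤ) ≡ (t : ℕ) [ZMOD p] := by
      rw [Int.modEq_iff_dvd] at h1 ⊢
      simpa using h1
    have h3 := h2.eq
    rw [Int.emod_eq_of_lt (by omega) (by exact_mod_cast s.2),
      Int.emod_eq_of_lt (by omega) (by exact_mod_cast t.2)] at h3
    exact Fin.ext (by exact_mod_cast h3)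
  have hprox : ∀ n, ∀ N : ℕ, ∃ m : ℤ, ∀ i : ℤ, i.natAbs ≤ N →
      desub τ x n (m + i) = desub τ y n (m + i) := by
    intro n
    induction n with
    | zero => rwa [hz.1, hw.1]
    | succ n ih =>
      intro N
      have hδε : δ n = ε n := hdigit _ _ _ _ (hz.mem_layer n) (hw.mem_layer n) ih
      -- The blocks indexed by |i| ≤ N reach at most pN + p - 1 from m, since both t and the offset
      -- s of m in its block are below p.
      obtain ⟨m, hm⟩ := ih (p * N + p)
      refine ⟨(m + (δ n : ℕ)) / p, fun i hi => ?_⟩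
      apply hτ.injective
      funext t
      rw [← hz.apply_block, ← hw.apply_block, ← hδε]
      obtain ⟨s, hs⟩ := exists_block (p := p) (m + (δ n : ℕ))
      have ht := t.2
      have hs' := s.2
      have h1 : (p : ℤ) * i ≤ p * N := by gcongr; omega
      have h2 : (p : ℤ) * (-N) ≤ p * i := by gcongr; omega
      convert hm (p * i + (t : ℕ) - (s : ℕ)) ?_ using 2
      · rw [mul_add]; omega
      · rw [mul_add]; omega
      · rw [mul_neg] at h2
        zify
        rw [abs_le]
        constructor <;> omega
  funext n
  exact hdigit _ _ _ _ (hz.mem_layer n) (hw.mem_layer n) (hprox n)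

theorem IsRecognizable.liYorkePairs_eq_empty [Finite A] (hτ : IsRecognizable τ) (hp : 2 ≤ p)
    (hcoinc : ¬ HasCoincidence τ) :
    liYorkePairs (substShift τ) seqDist shift = ∅ := by
  refine Set.eq_empty_iff_forall_notMem.2 ?_
  rintro ⟨x, y⟩ ⟨hprox, hasymp⟩
  have hx : x ∈ substShift τ := hprox.1
  have hy : y ∈ substShift τ := hprox.2.1
  have hxy := hτ.odometerMap_eq_of_proximal hx hy
    (exists_forall_eq_of_mem_proximalPairs hprox)
  by_cases h : ∃ i : ℤ, x i ≠ y i ∧ (iPlus τ (shiftPow i x)).Infinite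
  · obtain ⟨i, hi, hinf⟩ := h
    have h1 := (hτ.mem_distalPairs hp hcoinc hx hy hxy hi hinf).2.2
    rw [hprox.2.2] at h1
    exact lt_irrefl _ h1
  · exact hasymp (hτ.mem_asymptoticPairs hp hx hy h)

end Fibre

end Subst

theorem proposition3p4 {A : Type*} [Finite A] (p : ℕ) [NeZero p] (hp : 2 ≤ p)
    (τ : A → Fin p → A) (hinj : Function.Injective τ) (hprim : Subst.IsPrimitive τ)
    (hinf : (Subst.substShift τ).Infinite) :
    (∀ x ∈ Subst.substShift τ, ∀ y ∈ Subst.substShift τ,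
      Subst.odometerMap τ x = Subst.odometerMap τ y →
      (Subst.iPlus τ x = Subst.iPlus τ y ∧ Subst.kPlus τ x = Subst.kPlus τ y) ∧
      ((x, y) ∈ Subst.asymptoticPairs (Subst.substShift τ) Subst.seqDist Subst.shift ↔
        ((Subst.iPlus τ x).Infinite ∧
          ∀ᶠ i : ℕ in Filter.atTop, Subst.sWord τ x i = Subst.sWord τ y i) ∨
        ((Subst.iPlus τ x).Finite ∧
          ∀ᶠ i : ℕ in Filter.atTop,
            Subst.sWord τ (Subst.shiftPow (Subst.kPlus τ x) x) i =
              Subst.sWord τ (Subst.shiftPow (Subst.kPlus τ x) y) i)) ∧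
      (¬ Subst.HasCoincidence τ →
        ((∃ i : ℤ, x i ≠ y i ∧ (Subst.iPlus τ (Subst.shiftPow i x)).Infinite) →
          (x, y) ∈ Subst.distalPairs (Subst.substShift τ) Subst.seqDist Subst.shift) ∧
        ((¬ ∃ i : ℤ, x i ≠ y i ∧ (Subst.iPlus τ (Subst.shiftPow i x)).Infinite) →
          (x, y) ∈ Subst.asymptoticPairs (Subst.substShift τ) Subst.seqDist Subst.shift))) ∧
    (¬ Subst.HasCoincidence τ →
      Subst.liYorkePairs (Subst.substShift τ) Subst.seqDist Subst.shift = ∅) := by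
  have hτ : Subst.IsRecognizable τ :=
    ⟨hinj, fun x hx => Subst.exists_mem_layer τ hp hprim hx,
      fun x a b ha hb => Subst.emod_eq_of_mem_layer τ hp hinj hprim hinf ha hb⟩
  refine ⟨fun x hx y hy hxy => ⟨⟨Subst.iPlus_congr hxy, Subst.kPlus_congr hxy⟩,
    hτ.mem_asymptoticPairs_iff hp hx hy hxy, fun hcoinc => ⟨?_, ?_⟩⟩,
    hτ.liYorkePairs_eq_empty hp⟩
  · rintro ⟨i, hi, hinf⟩
    exact hτ.mem_distalPairs hp hcoinc hx hy hxy hi hinf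
  · exact hτ.mem_asymptoticPairs hp hx hy
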